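/- Consider a loss system with $K$ customer classes, $m_k$ layer-1 servers dedicated to class $k$ ($k=1,\dots,K$), and $n$ layer-2 servers that can serve all classes. Class-$k$ customers arrive at rate $\lambda_k\ge 0$ and are served at rate $\mu_k\ge 0$. An arriving class-$k$ customer is assigned to layer 1 if a class-$k$ server is vacant there, otherwise to layer 2 if a server is vacant there, and is rejected otherwise. Let $X_{i,k}(t)$ be the number of class-$k$ customers in service at layer $i$ at time $t$. Thus $X=(X_{i,k})$ is the continuous-time Markov process with right-continuous paths with left-hand limits on $$S=\Big\{x\in\mathbb{Z}_+^K\times\mathbb{Z}_+^K:\ x_{1,k}\le m_k\ \text{for all } k,\ \sum_{k=1}^K x_{2,k}\le n\Big\}$$ with the transitions, for $i\in\{1,2\}$ and $k\in\{1,\dots,K\}$, $x\mapsto x+e_{i,k}$ at rate $\lambda_k 1(x\in A_{i,k})$ and $x\mapsto x-e_{i,k}$ at rate $\mu_k x_{i,k}$, where $e_{i,k}$ is the unit vector in the coordinate direction $(i,k)$, $A_{1,k}=\{x\in S: x_{1,k}<m_k\}$ and $A_{2,k}=\{x\in S: x_{1,k}=m_k,\ \sum_{l} x_{2,l}<n\}$.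 For an integer $s\ge 0$ let $Z^{s}_{\lambda,\mu}$ denote the number of customers in the $s$-server Erlang loss system: the Markov process on $\{0,1,\dots,s\}$ with right-continuous paths with left-hand limits and with the transitions $x\mapsto x+1$ at rate $\lambda 1(x<s)$ and $x\mapsto x-1$ at rate $\mu x$. Fix a class $k$, and let $X$ and $Z^{m_k+n}_{\lambda_k,\mu_k}$ be such processes, with arbitrary initial distributions, defined on a common probability space. Assume that $X_{1,k}(0)+X_{2,k}(0)\le Z^{m_k+n}_{\lambda_k,\mu_k}(0)$ almost surely. Then $$X_{1,k}+X_{2,k}\ \le_{\rm st}\ Z^{m_k+n}_{\lambda_k,\mu_k},$$ that is, $\operatorname{E} f(X_{1,k}+X_{2,k})\le \operatorname{E} f(Z^{m_k+n}_{\lambda_k,\mu_k})$ for every bounded measurable function $f:D(\mathbb{R}_+,\mathbb{R})\to\mathbb{R}$ that is increasing with respect to the pointwise order, where $D(\mathbb{R}_+,\mathbb{R})$ is the space of right-continuous functions $\mathbb{R}_+\to\mathbb{R}$ with left-hand limits, with the Borel $\sigma$-algebra of the Skorohod topology (equivalently, the one generated by the evaluations). -/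

import Mathlib

open MeasureTheory Filter Topology
open scoped NNReal

namespace LossSystem

/-! ### Path space and stochastic order -/

/-- A path `f : ℝ₊ → E` is right-continuous with left-hand limits. -/
def IsCadlag {E : Type*} [TopologicalSpace E] (f : ℝ≥0 → E) : Prop :=
  ∀ t : ℝ≥0, ContinuousWithinAt f (Set.Ici t) t ∧ ∃ l : E, Tendsto f (𝓝[<] t) (𝓝 l)

/-- The path space `D(ℝ₊, E)`. As a subtype of `ℝ≥0 → E` it carries the sigma-algebra generated by
the evaluations `f ↦ f t` (for `E = ℝ`, or `E` discrete and countable, this is the Borel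
sigma-algebra of the Skorohod topology) and, if `E` is ordered, the pointwise order. -/
abbrev CadlagPath (E : Type*) [TopologicalSpace E] : Type _ :=
  {f : ℝ≥0 → E // IsCadlag f}

/-- The path `t ↦ g (f t)`, for a continuous map `g`. -/
def CadlagPath.comp {E F : Type*} [TopologicalSpace E] [TopologicalSpace F]
    (g : E → F) (hg : Continuous g) (f : CadlagPath E) : CadlagPath F :=
  ⟨fun t => g (f.1 t), fun t =>
    ⟨hg.continuousAt.comp_continuousWithinAt (f.2 t).1,
      (f.2 t).2.elim fun l hl => ⟨g l, (hg.tendsto l).comp hl⟩⟩⟩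

/-- The usual stochastic order `U ≤_st V`: `E φ(U) ≤ E φ(V)` for all bounded measurable
increasing real functions `φ`. The random elements `U`, `V` are meant to be measurable. -/
def StochLE {Ω Ω' α : Type*} [MeasurableSpace Ω] [MeasurableSpace Ω'] [MeasurableSpace α]
    [Preorder α] (P : Measure Ω) (P' : Measure Ω') (U : Ω → α) (V : Ω' → α) : Prop :=
  ∀ φ : α → ℝ, Measurable φ → (∃ C : ℝ, ∀ a, |φ a| ≤ C) → Monotone φ →
    ∫ ω, φ (U ω) ∂P ≤ ∫ ω, φ (V ω) ∂P'

/-! ### Markov jump processes on a finite state space -/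

/-- The generator matrix of the transition rates `q x y` (`x ≠ y`): its off-diagonal entries are
`q x y` and its rows sum to zero. The values `q x x` are irrelevant. -/
def generator {E : Type*} [Fintype E] [DecidableEq E] (q : E → E → ℝ) : Matrix E E ℝ :=
  Matrix.of q - Matrix.diagonal fun x => ∑ y, q x y

/-- `X` is a continuous-time Markov process on the finite set `E`, with paths in `D(ℝ₊, E)`,
arbitrary initial distribution and transition rates `q`: its finite-dimensional distributions are
those given by the transition matrices `exp (t Q)`, `t ≥ 0`, with `Q` the generator matrix. -/
def IsMarkovProcess {Ω E : Type*} [MeasurableSpace Ω] [Fintype E] [DecidableEq E]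
    [TopologicalSpace E] [MeasurableSpace E]
    (P : Measure Ω) (q : E → E → ℝ) (X : Ω → CadlagPath E) : Prop :=
  Measurable X ∧
    ∀ (N : ℕ) (t : Fin (N + 1) → ℝ≥0), Monotone t → ∀ x : Fin (N + 1) → E,
      P.real {ω | ∀ j, (X ω).1 (t j) = x j} =
        P.real {ω | (X ω).1 (t 0) = x 0} *
          ∏ j : Fin N, NormedSpace.exp (((t j.succ : ℝ) - (t j.castSucc : ℝ)) • generator q)
            (x j.castSucc) (x j.succ)

/-! ### The two-layer loss system with overflow routing

There are `K` customer classes, `m k` servers of layer 1 dedicated to class `k`, and `n` servers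
of layer 2. The layers 1 and 2 have the indices `0` and `1` in `Fin 2`. -/

/-- The state space: `x i k` is the number of class-`k` customers in service at layer `i`. -/
abbrev State {K : ℕ} (m : Fin K → ℕ) (n : ℕ) : Type :=
  {x : Fin 2 → Fin K → ℕ // (∀ k, x 0 k ≤ m k) ∧ ∑ k, x 1 k ≤ n}

instance {K : ℕ} (m : Fin K → ℕ) (n : ℕ) : Finite (State m n) := by
  refine Set.Finite.to_subtype
    ((Set.finite_Iic (fun (_ : Fin 2) (k : Fin K) => m k + n)).subset ?_)
  rintro x ⟨h0, h1⟩ i k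
  have h2 : x 1 k ≤ ∑ l, x 1 l :=
    Finset.single_le_sum (fun l _ => Nat.zero_le (x 1 l)) (Finset.mem_univ k)
  have h3 := h0 k
  fin_cases i
  · show x 0 k ≤ m k + n
    omega
  · show x 1 k ≤ m k + n
    omega

noncomputable instance {K : ℕ} (m : Fin K → ℕ) (n : ℕ) : Fintype (State m n) :=
  Fintype.ofFinite _

/-- The unit vector in the coordinate direction `(i, k)`. -/
def unitVec {K : ℕ} (i : Fin 2) (k : Fin K) : Fin 2 → Fin K → ℕ :=
  Pi.single i (Pi.single k 1)

/-- The set of states where an arriving class-`k` customer is assigned to a layer-`i` server. -/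
def assignSet {K : ℕ} (m : Fin K → ℕ) (n : ℕ) (i : Fin 2) (k : Fin K) : Set (State m n) :=
  match i with
  | 0 => {x | x.1 0 k < m k}
  | 1 => {x | x.1 0 k = m k ∧ ∑ l, x.1 1 l < n}

/-- The transition rates of the two-layer loss system: for all `i` and `k`, an upward transition
`x ↦ x + unitVec i k` at rate `lam k` if `x ∈ assignSet m n i k`, and a downward transition
`x ↦ x - unitVec i k` at rate `mu k * x i k`. -/
noncomputable def twoLayerRate {K : ℕ} (m : Fin K → ℕ) (n : ℕ) (lam mu : Fin K → ℝ)
    (x y : State m n) : ℝ :=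
  ∑ i, ∑ k,
    ((if y.1 = x.1 + unitVec i k then (assignSet m n i k).indicator (fun _ => lam k) x else 0) +
      (if x.1 = y.1 + unitVec i k then mu k * (x.1 i k : ℝ) else 0))

/-- The total number of class-`k` customers in the state `x`. -/
def classTotal {K : ℕ} (m : Fin K → ℕ) (n : ℕ) (k : Fin K) (x : State m n) : ℕ :=
  x.1 0 k + x.1 1 k

/-- The process `X_{1,k} + X_{2,k}`, with paths in `D(ℝ₊, ℝ)`. -/
def classProcess {Ω : Type*} {K : ℕ} {m : Fin K → ℕ} {n : ℕ} (k : Fin K)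
    (X : Ω → CadlagPath (State m n)) (ω : Ω) : CadlagPath ℝ :=
  (X ω).comp (fun x => (classTotal m n k x : ℝ)) continuous_of_discreteTopology

/-! ### The Erlang loss system -/

/-- The transition rates of the Erlang loss system with `s` servers, on `{0, …, s}`: upward
transitions `x ↦ x + 1` at rate `lam` if `x < s`, downward transitions `x ↦ x - 1` at rate
`mu * x`. -/
def erlangRate (s : ℕ) (lam mu : ℝ) (x y : Fin (s + 1)) : ℝ :=
  (if (y : ℕ) = (x : ℕ) + 1 ∧ (x : ℕ) < s then lam else 0) +
    (if (x : ℕ) = (y : ℕ) + 1 then mu * ((x : ℕ) : ℝ) else 0)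

/-- A process with values in `{0, …, s}`, regarded as a process with paths in `D(ℝ₊, ℝ)`. -/
def erlangProcess {Ω : Type*} {s : ℕ} (Z : Ω → CadlagPath (Fin (s + 1))) (ω : Ω) :
    CadlagPath ℝ :=
  (Z ω).comp (fun x : Fin (s + 1) => ((x : ℕ) : ℝ)) continuous_of_discreteTopology

end LossSystem

/-!
The two systems are coupled so that the number of class-`k` customers in the two-layer system never
exceeds the number of customers in the Erlang system. Class-`k` arrivals are common to both systems,
each class-`k` customer of the two-layer system is paired with a customer of the Erlang system and
leaves together with it, and the excess customers of the Erlang system leave on their own. The order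
survives an arrival because the two-layer system holds at most `m k + n` class-`k` customers. The
state space `CoupledState` of the coupling consists of ordered pairs only, so the order need not be
propagated in time; it remains to check that the generator of the coupling projects to the two given
generators (`sum_coupledRate_fst`, `sum_coupledRate_snd`).

An intertwining of generators passes to the transition matrices (`exp_mul_eq_mul_exp`,
`sum_transition_fiber`) and from there to the finite-dimensional distributions
(`chainLaw_preimage`). The coupled process is needed only at rational times. Its law there is a limit
point of the laws of the chain sampled at finitely many times, which exists since the probability
measures on the compact space `ℚ≥0 → C` form a compact space (`exists_limit_sampledLaw`), and its
marginals are the laws of `X` and `Z` at rational times (`map_limit_sampledLaw`).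

Path regularity of the coupled process need not be proved: the functions of rational times that extend
to càdlàg paths form a measurable set (`IsRegular`, `measurableSet_isRegular`), and they have full
measure under the marginals because `X` and `Z` have càdlàg paths. Extending both components
measurably (`measurable_extend`) gives ordered path-valued random elements with the laws of `X` and
`Z` (`stochLE_comp_of_coupling`).
-/

namespace LossSystem

/-! ### Transition matrices of a finite Markov jump process -/

section Exponential

variable {C E : Type*} [Fintype C] [DecidableEq C] [Fintype E] [DecidableEq E]

open scoped Matrix.Norms.Operator in
theorem hasSum_matrix_exp (A : Matrix E E ℝ) :
    HasSum (fun n : ℕ => (n.factorial⁻¹ : ℝ) • A ^ n) (NormedSpace.exp A) :=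
  NormedSpace.exp_series_hasSum_exp' (𝕂 := ℝ) A

/-- An intertwining relation `A M = M B` is inherited by the exponentials. -/
theorem exp_mul_eq_mul_exp {A : Matrix C C ℝ} {B : Matrix E E ℝ} {M : Matrix C E ℝ}
    (h : A * M = M * B) : NormedSpace.exp A * M = M * NormedSpace.exp B := by
  have hpow : ∀ n : ℕ, A ^ n * M = M * B ^ n := by
    intro n
    induction n with
    | zero => simp
    | succ n ih => rw [pow_succ, Matrix.mul_assoc, h, ← Matrix.mul_assoc, ih, Matrix.mul_assoc,
        ← pow_succ]
  have h1 := (hasSum_matrix_exp A).map (AddMonoidHom.mk' (fun N : Matrix C C ℝ => N * M)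
    fun a b => Matrix.add_mul a b M) (continuous_id.matrix_mul continuous_const)
  have h2 := (hasSum_matrix_exp B).map (AddMonoidHom.mk' (fun N : Matrix E E ℝ => M * N)
    fun a b => Matrix.mul_add M a b) (continuous_const.matrix_mul continuous_id)
  refine h1.unique (h2.congr_fun fun n => ?_)
  simp [hpow n]

theorem exp_apply_nonneg_of_nonneg {A : Matrix E E ℝ} (hA : ∀ x y, 0 ≤ A x y) (x y : E) :
    0 ≤ NormedSpace.exp A x y := by
  have hpow : ∀ (n : ℕ) x y, 0 ≤ (A ^ n) x y := by
    intro n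
    induction n with
    | zero =>
      intro x y
      rw [pow_zero, Matrix.one_apply]
      split_ifs <;> norm_num
    | succ n ih =>
      intro x y
      rw [pow_succ, Matrix.mul_apply]
      exact Finset.sum_nonneg fun z _ => mul_nonneg (ih x z) (hA z y)
  have h := Pi.hasSum.1 (Pi.hasSum.1 (hasSum_matrix_exp A) x) y
  exact h.nonneg fun n => mul_nonneg (by positivity) (hpow n x y)

variable (q : E → E → ℝ)

/-- The transition matrix over a time interval of length `t`. -/
noncomputable def transition (t : ℝ) : Matrix E E ℝ :=
  NormedSpace.exp (t • generator q)

theorem transition_add (s t : ℝ) : transition q (s + t) = transition q s * transition q t := by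
  rw [transition, add_smul]
  exact Matrix.exp_add_of_commute _ _ (((Commute.refl _).smul_left _).smul_right _)

theorem generator_mulVec (f : E → ℝ) (x : E) :
    (generator q).mulVec f x = ∑ y, q x y * (f y - f x) := by
  rw [generator, Matrix.sub_mulVec, Pi.sub_apply, Matrix.mulVec_diagonal, Finset.sum_mul,
    Matrix.mulVec, dotProduct, ← Finset.sum_sub_distrib]
  exact Finset.sum_congr rfl fun y _ => by rw [Matrix.of_apply, mul_sub]

/-- Rows of transition matrices sum to one. -/
theorem transition_sum (t : ℝ) (x : E) : ∑ y, transition q t x y = 1 := by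
  have h : (t • generator q) * (Matrix.of fun (_ : E) (_ : Unit) => (1 : ℝ)) =
      (Matrix.of fun (_ : E) (_ : Unit) => (1 : ℝ)) * (0 : Matrix Unit Unit ℝ) := by
    ext x u
    have := generator_mulVec q (fun _ => 1) x
    simp only [sub_self, mul_zero, Finset.sum_const_zero] at this
    rw [Matrix.smul_mul, Matrix.mul_zero, Matrix.smul_apply, Matrix.mul_apply]
    simp only [Matrix.mulVec, dotProduct] at this
    simp only [Matrix.of_apply, this, smul_zero, Matrix.zero_apply]
  have h2 := congrFun (congrFun (exp_mul_eq_mul_exp h) x) ()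
  simpa [Matrix.mul_apply, transition] using h2

variable {q}

theorem transition_nonneg (hq : ∀ x y, 0 ≤ q x y) {t : ℝ} (ht : 0 ≤ t) (x y : E) :
    0 ≤ transition q t x y := by
  -- Adding a multiple of the identity makes the generator entrywise nonnegative.
  set c : ℝ := t * ∑ x, ∑ y, q x y with hc
  have hA : ∀ x y, 0 ≤ (t • generator q + c • (1 : Matrix E E ℝ)) x y := by
    intro x y
    have h1 : ∑ y, q x y ≤ ∑ x, ∑ y, q x y :=
      Finset.single_le_sum (f := fun x => ∑ y, q x y)
        (fun x _ => Finset.sum_nonneg fun y _ => hq x y) (Finset.mem_univ x)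
    have h2 := mul_le_mul_of_nonneg_left h1 ht
    have h3 := mul_nonneg ht (hq x y)
    simp only [generator, Matrix.add_apply, Matrix.smul_apply, Matrix.sub_apply, Matrix.of_apply,
      smul_eq_mul, Matrix.diagonal_apply, Matrix.one_apply]
    split_ifs <;> linarith
  have hexp : NormedSpace.exp ((-c) • (1 : Matrix E E ℝ)) = Real.exp (-c) • 1 := by
    have : (-c) • (1 : Matrix E E ℝ) = Matrix.diagonal fun _ => -c := by
      rw [Matrix.smul_one_eq_diagonal]
    rw [this, Matrix.exp_diagonal, Matrix.smul_one_eq_diagonal]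
    congr 1
    ext i
    rw [Pi.coe_exp, Real.exp_eq_exp_ℝ]
  have hsplit : t • generator q =
      (t • generator q + c • (1 : Matrix E E ℝ)) + (-c) • (1 : Matrix E E ℝ) := by
    rw [add_assoc, ← add_smul, add_neg_cancel, zero_smul, add_zero]
  rw [transition, hsplit,
    Matrix.exp_add_of_commute _ _ ((Commute.one_right _).smul_right _), hexp,
    Matrix.mul_smul, Matrix.mul_one, Matrix.smul_apply, smul_eq_mul]
  exact mul_nonneg (Real.exp_pos _).le (exp_apply_nonneg_of_nonneg hA x y)

/-- If `π` maps the jump rates `r` on `C` to the jump rates `q` on `E`, in the sense that the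
generators satisfy `(Q̂ (f ∘ π)) = (Q f) ∘ π` for all `f`, then the transition probabilities from
`c` to the fibres of `π` are those of `q` from `π c`. -/
theorem sum_transition_fiber {r : C → C → ℝ} (π : C → E)
    (h : ∀ (f : E → ℝ) (c : C),
      ∑ d, r c d * (f (π d) - f (π c)) = ∑ y, q (π c) y * (f y - f (π c)))
    (t : ℝ) (c : C) (y : E) :
    ∑ d with π d = y, transition r t c d = transition q t (π c) y := by
  set M : Matrix C E ℝ := Matrix.of fun c y => if π c = y then 1 else 0 with hM
  have hint : (t • generator r) * M = M * (t • generator q) := by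
    rw [Matrix.smul_mul, Matrix.mul_smul]
    congr 1
    ext c y
    have h1 := h (fun x => if x = y then 1 else 0) c
    rw [← generator_mulVec q (fun x => if x = y then 1 else 0),
      ← generator_mulVec r (fun d => if π d = y then 1 else 0)] at h1
    simpa [Matrix.mul_apply, Matrix.mulVec, dotProduct, hM] using h1
  have := congrFun (congrFun (exp_mul_eq_mul_exp hint) c) y
  simpa [Matrix.mul_apply, hM, Finset.sum_filter, transition] using this

end Exponential

/-! ### Finite-dimensional distributions -/

section ChainLaw

open scoped ENNReal

variable {C E : Type*} [Fintype C] [DecidableEq C] [Fintype E] [DecidableEq E]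

/-- The transition probability from `x` at time `s` to `y` at time `t`, as an extended nonnegative
real. -/
noncomputable def stepProb (q : E → E → ℝ) (s t : ℝ≥0) (x y : E) : ℝ≥0∞ :=
  ENNReal.ofReal (transition q ((t : ℝ) - (s : ℝ)) x y)

section StepProb

variable {q : E → E → ℝ}

theorem stepProb_sum (hq : ∀ x y, 0 ≤ q x y) {s t : ℝ≥0} (h : s ≤ t) (x : E) :
    ∑ y, stepProb q s t x y = 1 := by
  have h' : 0 ≤ (t : ℝ) - s := sub_nonneg.2 (NNReal.coe_le_coe.2 h)
  simp only [stepProb]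
  rw [← ENNReal.ofReal_sum_of_nonneg fun y _ => transition_nonneg hq h' x y, transition_sum,
    ENNReal.ofReal_one]

theorem sum_stepProb_mul_stepProb (hq : ∀ x y, 0 ≤ q x y) {s t u : ℝ≥0} (h : s ≤ t)
    (h' : t ≤ u) (x z : E) :
    ∑ y, stepProb q s t x y * stepProb q t u y z = stepProb q s u x z := by
  have h1 : 0 ≤ (t : ℝ) - s := sub_nonneg.2 (NNReal.coe_le_coe.2 h)
  have h2 : 0 ≤ (u : ℝ) - t := sub_nonneg.2 (NNReal.coe_le_coe.2 h')
  have h3 : (u : ℝ) - s = (t - s) + (u - t) := by ring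
  simp only [stepProb]
  rw [h3, transition_add, Matrix.mul_apply, ENNReal.ofReal_sum_of_nonneg fun y _ =>
    mul_nonneg (transition_nonneg hq h1 x y) (transition_nonneg hq h2 y z)]
  exact Finset.sum_congr rfl fun y _ => (ENNReal.ofReal_mul (transition_nonneg hq h1 x y)).symm

theorem sum_stepProb_fiber {r : C → C → ℝ} (hr : ∀ c d, 0 ≤ r c d) {π : C → E}
    (h : ∀ (f : E → ℝ) (c : C),
      ∑ d, r c d * (f (π d) - f (π c)) = ∑ y, q (π c) y * (f y - f (π c)))
    {s t : ℝ≥0} (hst : s ≤ t) (c : C) (y : E) :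
    ∑ d with π d = y, stepProb r s t c d = stepProb q s t (π c) y := by
  have h' : 0 ≤ (t : ℝ) - s := sub_nonneg.2 (NNReal.coe_le_coe.2 hst)
  simp only [stepProb]
  rw [← ENNReal.ofReal_sum_of_nonneg fun d _ => transition_nonneg hr h' c d,
    sum_transition_fiber π h]

end StepProb

variable [MeasurableSpace C] [MeasurableSpace E]

/-- The law of the function obtained from `f` by resampling its values at the times in the list `l`
along the Markov chain started from `x` at time `s`. The list is meant to be increasing and to lie
in `[s, ∞)`. -/
noncomputable def chainLaw (q : E → E → ℝ) :
    List ℚ≥0 → ℚ≥0 → E → (ℚ≥0 → E) → Measure (ℚ≥0 → E)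
  | [], _, _, f => Measure.dirac f
  | t :: l, s, x, f => ∑ y, stepProb q s t x y • chainLaw q l t y (Function.update f t y)

theorem chainLaw_cons_apply (q : E → E → ℝ) (t : ℚ≥0) (l : List ℚ≥0) (s : ℚ≥0) (x : E)
    (f : ℚ≥0 → E) (S : Set (ℚ≥0 → E)) :
    chainLaw q (t :: l) s x f S =
      ∑ y, stepProb q s t x y * chainLaw q l t y (Function.update f t y) S := by
  simp [chainLaw, Measure.finsetSum_apply]

theorem nnratCast_le_of_pairwise {s t : ℚ≥0} {l : List ℚ≥0}
    (h : (s :: t :: l).Pairwise (· ≤ ·)) : (s : ℝ≥0) ≤ (t : ℝ≥0) :=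
  NNRat.cast_le.2 ((List.pairwise_cons.1 h).1 t (by simp))

theorem chainLaw_univ {q : E → E → ℝ} (hq : ∀ x y, 0 ≤ q x y) (l : List ℚ≥0) :
    ∀ (s : ℚ≥0) (x : E) (f : ℚ≥0 → E), (s :: l).Pairwise (· ≤ ·) →
      chainLaw q l s x f Set.univ = 1 := by
  induction l with
  | nil => intro s x f _; simp [chainLaw]
  | cons t l ih =>
    intro s x f h
    rw [chainLaw_cons_apply]
    simp only [ih t _ _ (List.pairwise_cons.1 h).2, mul_one]
    exact stepProb_sum hq (nnratCast_le_of_pairwise h) x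

/-- The image of a chain under a map that intertwines the generators is again such a chain. -/
theorem chainLaw_preimage {q : E → E → ℝ} {r : C → C → ℝ}
    (hr : ∀ c d, 0 ≤ r c d) {π : C → E} (hπm : Measurable π)
    (h : ∀ (f : E → ℝ) (c : C),
      ∑ d, r c d * (f (π d) - f (π c)) = ∑ y, q (π c) y * (f y - f (π c)))
    {S : Set (ℚ≥0 → E)} (hS : MeasurableSet S) (l : List ℚ≥0) :
    ∀ (s : ℚ≥0) (c : C) (f : ℚ≥0 → C), (s :: l).Pairwise (· ≤ ·) →
      chainLaw r l s c f {g | (fun t => π (g t)) ∈ S} =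
        chainLaw q l s (π c) (fun t => π (f t)) S := by
  induction l with
  | nil =>
    intro s c f _
    have hm : Measurable fun (g : ℚ≥0 → C) t => π (g t) :=
      measurable_pi_lambda _ fun t => hπm.comp (measurable_pi_apply t)
    exact (Measure.dirac_apply' f (hm hS)).trans (Measure.dirac_apply' _ hS).symm
  | cons t l ih =>
    intro s c f hl
    have hupd : ∀ d, (fun u => π (Function.update f t d u)) =
        Function.update (fun u => π (f u)) t (π d) := fun d => by
      ext u
      by_cases hu : u = t
      · subst hu; simp
      · simp [Function.update_of_ne hu]
    rw [chainLaw_cons_apply, chainLaw_cons_apply]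
    simp only [ih t _ _ (List.pairwise_cons.1 hl).2, hupd]
    rw [← Finset.sum_fiberwise Finset.univ π]
    refine Finset.sum_congr rfl fun y _ => ?_
    rw [← sum_stepProb_fiber hr h (nnratCast_le_of_pairwise hl) c y, Finset.sum_mul]
    refine Finset.sum_congr rfl fun d hd => ?_
    rw [(Finset.mem_filter.1 hd).2]

theorem chainLaw_congr {q : E → E → ℝ} {J : Set ℚ≥0} {S : Set (ℚ≥0 → E)} (hS : MeasurableSet S)
    (hJ : DependsOn (· ∈ S) J) (l : List ℚ≥0) :
    ∀ (s : ℚ≥0) (x : E) (f g : ℚ≥0 → E), (∀ t ∈ J, f t = g t) →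
      chainLaw q l s x f S = chainLaw q l s x g S := by
  induction l with
  | nil =>
    intro s x f g h
    simp only [chainLaw]
    rw [Measure.dirac_apply' _ hS, Measure.dirac_apply' _ hS]
    by_cases hf : f ∈ S
    · rw [Set.indicator_of_mem hf, Set.indicator_of_mem ((hJ h).mp hf)]
      rfl
    · rw [Set.indicator_of_notMem hf, Set.indicator_of_notMem fun hg => hf ((hJ h).mpr hg)]
  | cons t l ih =>
    intro s x f g h
    rw [chainLaw_cons_apply, chainLaw_cons_apply]
    refine Finset.sum_congr rfl fun y _ => ?_
    rw [ih t y _ (Function.update g t y) fun u hu => ?_]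
    by_cases hut : u = t
    · subst hut; simp
    · simp [Function.update_of_ne hut, h u hu]

/-- Consistency of the finite-dimensional distributions: a sampling time outside of `J` does not
influence the probability of an event that depends only on the times in `J`. This is the
Chapman–Kolmogorov equation. -/
theorem chainLaw_cons_of_notMem {q : E → E → ℝ} (hq : ∀ x y, 0 ≤ q x y) {J : Set ℚ≥0}
    {S : Set (ℚ≥0 → E)} (hS : MeasurableSet S) (hJ : DependsOn (· ∈ S) J) {t : ℚ≥0} (ht : t ∉ J)
    (l : List ℚ≥0) (s : ℚ≥0) (x : E) (f : ℚ≥0 → E) (hl : (s :: t :: l).Pairwise (· ≤ ·)) :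
    chainLaw q (t :: l) s x f S = chainLaw q l s x f S := by
  have hupd : ∀ (y : E) (u : ℚ≥0), u ∈ J → Function.update f t y u = f u := fun y u hu =>
    Function.update_of_ne (fun h : u = t => ht (h ▸ hu)) _ _
  have hst := nnratCast_le_of_pairwise hl
  rw [chainLaw_cons_apply]
  cases l with
  | nil =>
    have : ∀ y, chainLaw q [] t y (Function.update f t y) S = chainLaw q [] s x f S := fun y =>
      chainLaw_congr hS hJ [] t y _ f (hupd y)
    simp only [this]
    rw [← Finset.sum_mul, stepProb_sum hq hst, one_mul]
  | cons u l =>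
    have htu := nnratCast_le_of_pairwise (List.pairwise_cons.1 hl).2
    simp only [chainLaw_congr hS hJ (u :: l) t _ _ f (hupd _)]
    simp only [chainLaw_cons_apply, Finset.mul_sum]
    rw [Finset.sum_comm]
    refine Finset.sum_congr rfl fun z _ => ?_
    rw [← sum_stepProb_mul_stepProb hq hst htu, Finset.sum_mul]
    exact Finset.sum_congr rfl fun y _ => (mul_assoc _ _ _).symm

theorem chainLaw_filter {q : E → E → ℝ} (hq : ∀ x y, 0 ≤ q x y) {J : Finset ℚ≥0}
    {S : Set (ℚ≥0 → E)} (hS : MeasurableSet S) (hJ : DependsOn (· ∈ S) (J : Set ℚ≥0))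
    (l : List ℚ≥0) :
    ∀ (s : ℚ≥0) (x : E) (f : ℚ≥0 → E), (s :: l).Pairwise (· ≤ ·) →
      chainLaw q l s x f S = chainLaw q (l.filter (· ∈ J)) s x f S := by
  induction l with
  | nil => intro s x f _; simp
  | cons t l ih =>
    intro s x f hl
    have hstep : chainLaw q (t :: l) s x f S =
        chainLaw q (t :: l.filter (· ∈ J)) s x f S := by
      rw [chainLaw_cons_apply, chainLaw_cons_apply]
      exact Finset.sum_congr rfl fun y _ => by rw [ih t _ _ (List.pairwise_cons.1 hl).2]
    by_cases ht : t ∈ J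
    · rw [hstep, List.filter_cons_of_pos (by simpa using ht)]
    · rw [hstep, List.filter_cons_of_neg (by simpa using ht)]
      exact chainLaw_cons_of_notMem hq hS hJ (by simpa using ht) _ s x f
        (hl.sublist ((List.filter_sublist.cons_cons t).cons_cons s))

theorem chainLaw_sort {q : E → E → ℝ} (hq : ∀ x y, 0 ≤ q x y) {I J : Finset ℚ≥0} (hJI : J ⊆ I)
    {S : Set (ℚ≥0 → E)} (hS : MeasurableSet S) (hJ : DependsOn (· ∈ S) (J : Set ℚ≥0))
    (x : E) (f : ℚ≥0 → E) :
    chainLaw q I.sort 0 x f S = chainLaw q J.sort 0 x f S := by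
  have hsort : I.sort.filter (· ∈ J) = J.sort := by
    refine List.Perm.eq_of_pairwise' ((Finset.pairwise_sort I (· ≤ ·)).filter _)
      (Finset.pairwise_sort J (· ≤ ·))
      ((List.perm_ext_iff_of_nodup ((Finset.sort_nodup I (· ≤ ·)).filter _)
        (Finset.sort_nodup J (· ≤ ·))).2
        fun t => ?_)
    simp only [List.mem_filter, Finset.mem_sort, decide_eq_true_eq]
    exact ⟨fun h => h.2, fun h => ⟨hJI h, h⟩⟩
  rw [chainLaw_filter hq hS hJ _ _ _ _ (List.pairwise_cons.2
    ⟨fun _ _ => zero_le, Finset.pairwise_sort I (· ≤ ·)⟩), hsort]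

end ChainLaw

section Cylinder

open scoped ENNReal

variable {E : Type*}

/-- The functions that agree with `e` on `J`. -/
def cylinderAt (J : Finset ℚ≥0) (e : ℚ≥0 → E) : Set (ℚ≥0 → E) :=
  {g | ∀ t ∈ J, g t = e t}

theorem measurableSet_cylinderAt [MeasurableSpace E] [MeasurableSingletonClass E]
    (J : Finset ℚ≥0) (e : ℚ≥0 → E) : MeasurableSet (cylinderAt J e) := by
  have : cylinderAt J e = ⋂ t ∈ J, (fun g : ℚ≥0 → E => g t) ⁻¹' {e t} := by
    ext g; simp [cylinderAt]
  rw [this]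
  exact Finset.measurableSet_biInter _ fun t _ => measurable_pi_apply t (measurableSet_singleton _)

theorem dependsOn_cylinderAt (J : Finset ℚ≥0) (e : ℚ≥0 → E) :
    DependsOn (· ∈ cylinderAt J e) (J : Set ℚ≥0) := fun _ _ h =>
  propext (forall₂_congr fun t ht => by rw [h t ht])

variable [Fintype E] [DecidableEq E]

/-- The probability that the Markov chain started from `x` at time `s` follows `e` along the times
in the list. -/
noncomputable def pathWeight (q : E → E → ℝ) (e : ℚ≥0 → E) : List ℚ≥0 → ℚ≥0 → E → ℝ≥0∞
  | [], _, _ => 1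
  | t :: l, s, x => stepProb q s t x (e t) * pathWeight q e l t (e t)

/-- The probability of a path in the form used by `IsMarkovProcess`. -/
theorem pathWeight_eq_prod {q : E → E → ℝ} (hq : ∀ x y, 0 ≤ q x y) (e : ℚ≥0 → E) (l : List ℚ≥0) :
    ∀ (s : ℚ≥0) (x : E), (s :: l).Pairwise (· ≤ ·) →
      pathWeight q e l s x = ENNReal.ofReal (∏ j : Fin l.length,
        NormedSpace.exp (((((s :: l).get j.succ : ℝ≥0) : ℝ) - (((s :: l).get j.castSucc : ℝ≥0) : ℝ))
          • generator q) ((x :: l.map e).get (j.castSucc.cast (by simp)))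
          ((x :: l.map e).get (j.succ.cast (by simp)))) := by
  induction l with
  | nil => intro s x _; simp [pathWeight]
  | cons t l ih =>
    intro s x h
    have hst : 0 ≤ ((t : ℝ≥0) : ℝ) - ((s : ℝ≥0) : ℝ) :=
      sub_nonneg.2 (NNReal.coe_le_coe.2 (nnratCast_le_of_pairwise h))
    rw [pathWeight, ih t (e t) (List.pairwise_cons.1 h).2, stepProb,
      ← ENNReal.ofReal_mul (transition_nonneg hq hst x (e t))]
    congr 1
    refine Eq.symm ((Fin.prod_univ_succ (M := ℝ) (n := l.length) _).trans ?_)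
    rfl

variable [MeasurableSpace E] [MeasurableSingletonClass E] {q : E → E → ℝ}

/-- A value at a time that is not resampled stays as it is. -/
theorem chainLaw_cylinderAt_eq_zero {J : Finset ℚ≥0} {e : ℚ≥0 → E} {u : ℚ≥0} (hu : u ∈ J)
    (l : List ℚ≥0) :
    ∀ (s : ℚ≥0) (x : E) (f : ℚ≥0 → E), u ∉ l → f u ≠ e u →
      chainLaw q l s x f (cylinderAt J e) = 0 := by
  induction l with
  | nil =>
    intro s x f _ hf
    simp only [chainLaw]
    rw [Measure.dirac_apply' _ (measurableSet_cylinderAt J e)]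
    exact Set.indicator_of_notMem (s := cylinderAt J e) (fun h => hf (h u hu)) _
  | cons t l ih =>
    intro s x f hul hf
    rw [List.mem_cons, not_or] at hul
    rw [chainLaw_cons_apply]
    refine Finset.sum_eq_zero fun y _ => ?_
    rw [ih t y _ hul.2 (by rwa [Function.update_of_ne hul.1]), mul_zero]

theorem chainLaw_cylinderAt_eq_pathWeight {J : Finset ℚ≥0} {e : ℚ≥0 → E} (l : List ℚ≥0) :
    ∀ (s : ℚ≥0) (x : E) (f : ℚ≥0 → E), l.Nodup → (∀ t ∈ l, t ∈ J) →
      (∀ t ∈ J, t ∉ l → f t = e t) →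
      chainLaw q l s x f (cylinderAt J e) = pathWeight q e l s x := by
  induction l with
  | nil =>
    intro s x f _ _ h
    simp only [chainLaw, pathWeight]
    rw [Measure.dirac_apply' _ (measurableSet_cylinderAt J e)]
    exact Set.indicator_of_mem (s := cylinderAt J e) (fun t ht => h t ht (by simp)) _
  | cons t l ih =>
    intro s x f hnd hlJ h
    rw [List.nodup_cons] at hnd
    rw [chainLaw_cons_apply, pathWeight, Finset.sum_eq_single (e t)]
    · rw [ih t (e t) _ hnd.2 (fun u hu => hlJ u (List.mem_cons_of_mem _ hu)) fun u huJ hul => ?_]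
      by_cases hut : u = t
      · subst hut; simp
      · rw [Function.update_of_ne hut]
        exact h u huJ (by simp [hut, hul])
    · intro y _ hy
      rw [chainLaw_cylinderAt_eq_zero (hlJ t (by simp)) l t y _ hnd.1 (by simpa using hy), mul_zero]
    · simp

end Cylinder

/-! ### Joint construction of Markov processes at rational times -/

section Coupling

open scoped ENNReal

theorem measure_ext_of_cylinderAt {E : Type*} [Finite E] [MeasurableSpace E]
    [MeasurableSingletonClass E] {μ ν : Measure (ℚ≥0 → E)} [IsFiniteMeasure μ]
    [IsFiniteMeasure ν] (h : ∀ J e, μ (cylinderAt J e) = ν (cylinderAt J e)) : μ = ν := by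
  refine IsProjectiveLimit.unique (P := fun J : Finset ℚ≥0 => ν.map J.restrict) (fun J => ?_)
    fun J => rfl
  refine Measure.ext_of_singleton fun a => ?_
  have hm : Measurable (J.restrict (π := fun _ : ℚ≥0 => E)) := Finset.measurable_restrict J
  rw [Measure.map_apply hm (measurableSet_singleton a),
    Measure.map_apply hm (measurableSet_singleton a)]
  rcases isEmpty_or_nonempty E with hE | hE
  · have : IsEmpty (ℚ≥0 → E) := ⟨fun f => hE.false (f 0)⟩
    simp [Measure.eq_zero_of_isEmpty μ, Measure.eq_zero_of_isEmpty ν]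
  · have : J.restrict (π := fun _ : ℚ≥0 => E) ⁻¹' {a} =
        cylinderAt J fun t => if ht : t ∈ J then a ⟨t, ht⟩ else hE.some := by
      ext g
      simp only [Set.mem_preimage, Set.mem_singleton_iff, cylinderAt, Set.mem_ofPred_eq, funext_iff,
        Subtype.forall]
      exact forall₂_congr fun t ht => by simp [ht]
    rw [this, h]

variable {Ω : Type*} [MeasurableSpace Ω] {P : Measure Ω}

/-- The restriction of a path to the rational times. -/
def CadlagPath.restrict {E : Type*} [TopologicalSpace E] (y : CadlagPath E) : ℚ≥0 → E :=
  fun t => y.1 t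

theorem CadlagPath.measurable_eval {E : Type*} [TopologicalSpace E] [MeasurableSpace E] (t : ℝ≥0) :
    Measurable fun y : CadlagPath E => y.1 t :=
  (measurable_pi_apply t).comp measurable_subtype_coe

theorem CadlagPath.measurable_restrict {E : Type*} [TopologicalSpace E] [MeasurableSpace E] :
    Measurable (CadlagPath.restrict (E := E)) :=
  measurable_pi_lambda _ fun _ => CadlagPath.measurable_eval _

section OneProcess

variable {E : Type*} [Fintype E] [DecidableEq E] [TopologicalSpace E] [MeasurableSpace E]
  {q : E → E → ℝ} {X : Ω → CadlagPath E}

/-- The defining property of a Markov process, for a finite set of times instead of a monotone tuple.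
The time `0` is put in front; it may also belong to `J`. -/
theorem IsMarkovProcess.measure_restrict_mem_cylinderAt [IsFiniteMeasure P]
    (hX : IsMarkovProcess P q X) (hq : ∀ x y, 0 ≤ q x y) (J : Finset ℚ≥0) (e : ℚ≥0 → E) (x : E) :
    P {ω | (X ω).1 0 = x ∧ (X ω).restrict ∈ cylinderAt J e} =
      P {ω | (X ω).1 0 = x} * pathWeight q e J.sort 0 x := by
  set l := J.sort with hl
  have hpw : (0 :: l).Pairwise (· ≤ ·) :=
    List.pairwise_cons.2 ⟨fun _ _ => zero_le, Finset.pairwise_sort J (· ≤ ·)⟩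
  have hmono : Monotone fun j : Fin (l.length + 1) => (((0 :: l).get j : ℚ≥0) : ℝ≥0) := by
    intro i j hij
    exact NNRat.cast_le.2 (hpw.rel_get_of_le hij)
  have h := hX.2 l.length (fun j => (((0 :: l).get j : ℚ≥0) : ℝ≥0)) hmono
    (fun j => (x :: l.map e).get (j.cast (by simp)))
  have h0 : {ω | ∀ j : Fin (l.length + 1), (X ω).1 (((0 :: l).get j : ℚ≥0) : ℝ≥0) =
      (x :: l.map e).get (j.cast (by simp))} =
      {ω | (X ω).1 0 = x ∧ (X ω).restrict ∈ cylinderAt J e} := by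
    ext ω
    simp only [Set.mem_ofPred_eq, Fin.forall_fin_succ, cylinderAt, CadlagPath.restrict]
    refine and_congr (by simp) ?_
    constructor
    · intro h t ht
      obtain ⟨i, hi⟩ := List.mem_iff_get.1 ((Finset.mem_sort (α := ℚ≥0) (· ≤ ·)).2 ht)
      have := h i
      simp only [List.get_eq_getElem, Fin.val_succ, List.getElem_cons_succ, Fin.val_cast,
        List.getElem_map] at this hi
      rw [← hi]
      exact this
    · intro h i
      have := h (l.get i) ((Finset.mem_sort (α := ℚ≥0) (· ≤ ·)).1 (List.get_mem l i))
      simpa using this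
  rw [h0] at h
  have h1 : (((0 :: l).get 0 : ℚ≥0) : ℝ≥0) = 0 := by simp
  simp only [h1] at h
  rw [pathWeight_eq_prod hq e l 0 x hpw, ← ofReal_measureReal, h,
    ENNReal.ofReal_mul measureReal_nonneg, ofReal_measureReal]
  rfl

end OneProcess

variable {C : Type*} [Fintype C] [DecidableEq C] [MeasurableSpace C]

/-- The law of the Markov chain with jump rates `r` and the initial distribution of `c₀`, sampled at
the times in `I` and equal to its initial state at the other times. -/
noncomputable def sampledLaw (P : Measure Ω) (c₀ : Ω → C) (r : C → C → ℝ) (I : Finset ℚ≥0) :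
    Measure (ℚ≥0 → C) :=
  ∑ c, P {ω | c₀ ω = c} • chainLaw r I.sort 0 c fun _ => c

theorem sampledLaw_apply (c₀ : Ω → C) (r : C → C → ℝ) (I : Finset ℚ≥0) (S : Set (ℚ≥0 → C)) :
    sampledLaw P c₀ r I S = ∑ c, P {ω | c₀ ω = c} * chainLaw r I.sort 0 c (fun _ => c) S := by
  simp [sampledLaw, Measure.finsetSum_apply]

theorem sum_measure_eq {A : Type*} [Fintype A] [DecidableEq A] [MeasurableSpace A]
    [MeasurableSingletonClass A] {a : Ω → A} (ha : Measurable a) (p : A → Prop) [DecidablePred p] :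
    ∑ c with p c, P {ω | a ω = c} = P {ω | p (a ω)} := by
  rw [← measure_biUnion_finset]
  · congr 1
    ext ω
    simp
  · intro c _ d _ hcd
    exact Set.disjoint_left.2 fun ω h h' => hcd (h.symm.trans h')
  · exact fun c _ => ha (measurableSet_singleton c)

variable [MeasurableSingletonClass C] {c₀ : Ω → C} {r : C → C → ℝ}

theorem isProbabilityMeasure_sampledLaw [IsProbabilityMeasure P] (hc₀ : Measurable c₀)
    (hr : ∀ c d, 0 ≤ r c d) (I : Finset ℚ≥0) : IsProbabilityMeasure (sampledLaw P c₀ r I) := by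
  refine ⟨?_⟩
  rw [sampledLaw_apply]
  simp only [chainLaw_univ hr I.sort 0 _ _ (List.pairwise_cons.2
    ⟨fun _ _ => zero_le, Finset.pairwise_sort I (· ≤ ·)⟩), mul_one]
  have := sum_measure_eq (P := P) hc₀ fun _ => True
  simpa using this

/-- By compactness, the laws sampled at finite sets of rational times have a limit along finer and
finer sets of times. -/
theorem exists_limit_sampledLaw [IsProbabilityMeasure P] [TopologicalSpace C] [DiscreteTopology C]
    (hc₀ : Measurable c₀) (hr : ∀ c d, 0 ≤ r c d) :
    ∃ μ : Measure (ℚ≥0 → C), IsProbabilityMeasure μ ∧ ∀ S : Set (ℚ≥0 → C), IsClopen S → ∀ a : ℝ≥0∞,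
      (∀ᶠ I in atTop, sampledLaw P c₀ r I S = a) → μ S = a := by
  have : BorelSpace C := ⟨by
    rw [borel_eq_top_of_discrete]
    exact MeasurableSpace.ext fun s => by simp [(Set.toFinite s).measurableSet]⟩
  let ν : Finset ℚ≥0 → ProbabilityMeasure (ℚ≥0 → C) := fun I =>
    ⟨sampledLaw P c₀ r I, isProbabilityMeasure_sampledLaw hc₀ hr I⟩
  let U : Ultrafilter (Finset ℚ≥0) := Ultrafilter.of atTop
  obtain ⟨μ, -, hμ⟩ := isCompact_univ.ultrafilter_le_nhds (U.map ν) (by simp)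
  refine ⟨μ, inferInstance, fun S hS a ha => ?_⟩
  have h1 := ProbabilityMeasure.tendsto_measure_of_null_frontier_of_tendsto'
    (show Tendsto ν (U : Filter _) (𝓝 μ) from hμ) (E := S) (by simp [hS.frontier_eq])
  have h2 : ∀ᶠ I in (U : Filter _), (ν I : Measure (ℚ≥0 → C)) S = a :=
    Ultrafilter.of_le atTop ha
  exact tendsto_nhds_unique h1 ((tendsto_congr' h2).2 tendsto_const_nhds)

variable {E : Type*} [Fintype E] [DecidableEq E] [TopologicalSpace E]
  [MeasurableSpace E] [MeasurableSingletonClass E] {q : E → E → ℝ} {X : Ω → CadlagPath E} {π : C → E}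

/-- Once the sampled times contain `J`, the image under `π` of the sampled chain has the distribution
of `X` at the times in `J`. -/
theorem sampledLaw_preimage_cylinderAt [IsProbabilityMeasure P] (hc₀ : Measurable c₀)
    (hr : ∀ c d, 0 ≤ r c d) (hq : ∀ x y, 0 ≤ q x y) (hX : IsMarkovProcess P q X)
    (hπ : ∀ᵐ ω ∂P, π (c₀ ω) = (X ω).1 0)
    (h : ∀ (f : E → ℝ) (c : C),
      ∑ d, r c d * (f (π d) - f (π c)) = ∑ y, q (π c) y * (f y - f (π c)))
    {I J : Finset ℚ≥0} (hJI : J ⊆ I) (e : ℚ≥0 → E) :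
    sampledLaw P c₀ r I {g | (fun t => π (g t)) ∈ cylinderAt J e} =
      P {ω | (X ω).restrict ∈ cylinderAt J e} := by
  have hpw : (0 :: I.sort).Pairwise (· ≤ ·) :=
    List.pairwise_cons.2 ⟨fun _ _ => zero_le, Finset.pairwise_sort I (· ≤ ·)⟩
  have hX0 : Measurable fun ω => (X ω).1 0 := (CadlagPath.measurable_eval 0).comp hX.1
  have hchain : ∀ c, chainLaw r I.sort 0 c (fun _ => c) {g | (fun t => π (g t)) ∈ cylinderAt J e} =
      pathWeight q e J.sort 0 (π c) := fun c => by
    rw [chainLaw_preimage hr (measurable_of_finite π) h (measurableSet_cylinderAt J e) _ _ _ _ hpw,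
      chainLaw_sort hq hJI (measurableSet_cylinderAt J e) (dependsOn_cylinderAt J e),
      chainLaw_cylinderAt_eq_pathWeight _ _ _ _ (Finset.sort_nodup J (· ≤ ·))]
    · exact fun t ht => (Finset.mem_sort _).1 ht
    · exact fun t ht h => absurd ((Finset.mem_sort _).2 ht) h
  have hfib : ∀ x, ∑ c with π c = x, P {ω | c₀ ω = c} = P {ω | (X ω).1 0 = x} := fun x => by
    rw [sum_measure_eq hc₀ fun c => π c = x]
    exact measure_congr (hπ.mono fun ω hω => propext (by
      change π (c₀ ω) = x ↔ (X ω).1 0 = x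
      rw [hω]))
  rw [sampledLaw_apply]
  simp only [hchain]
  rw [← Finset.sum_fiberwise Finset.univ π]
  have hx : ∀ x, ∑ c with π c = x, P {ω | c₀ ω = c} * pathWeight q e J.sort 0 (π c) =
      P {ω | (X ω).1 0 = x ∧ (X ω).restrict ∈ cylinderAt J e} := fun x => by
    rw [hX.measure_restrict_mem_cylinderAt hq, ← hfib, Finset.sum_mul]
    exact Finset.sum_congr rfl fun c hc => by rw [(Finset.mem_filter.1 hc).2]
  simp only [hx]
  rw [← measure_biUnion_finset]
  · congr 1
    ext ω
    simp
  · intro x _ y _ hxy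
    exact Set.disjoint_left.2 fun ω h h' => hxy (h.1.symm.trans h'.1)
  · exact fun x _ => (hX0 (measurableSet_singleton x)).inter
      ((CadlagPath.measurable_restrict.comp hX.1) (measurableSet_cylinderAt J e))

/-- Under the limit law, the image of the process under `π` has the law of `X` at rational times. -/
theorem map_limit_sampledLaw [IsProbabilityMeasure P] [DiscreteTopology E]
    [TopologicalSpace C] [DiscreteTopology C]
    (hc₀ : Measurable c₀) (hr : ∀ c d, 0 ≤ r c d) (hq : ∀ x y, 0 ≤ q x y)
    (hX : IsMarkovProcess P q X) (hπ : ∀ᵐ ω ∂P, π (c₀ ω) = (X ω).1 0)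
    (h : ∀ (f : E → ℝ) (c : C),
      ∑ d, r c d * (f (π d) - f (π c)) = ∑ y, q (π c) y * (f y - f (π c)))
    {μ : Measure (ℚ≥0 → C)} [IsProbabilityMeasure μ]
    (hμ : ∀ S : Set (ℚ≥0 → C), IsClopen S → ∀ a : ℝ≥0∞,
      (∀ᶠ I in atTop, sampledLaw P c₀ r I S = a) → μ S = a) :
    μ.map (fun g t => π (g t)) = P.map fun ω => (X ω).restrict := by
  have hπm : Measurable fun (g : ℚ≥0 → C) t => π (g t) :=
    measurable_pi_lambda _ fun t => (measurable_of_finite π).comp (measurable_pi_apply t)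
  have hπc : Continuous fun (g : ℚ≥0 → C) t => π (g t) :=
    continuous_pi fun t => continuous_of_discreteTopology.comp (continuous_apply t)
  have hXm : Measurable fun ω => (X ω).restrict := CadlagPath.measurable_restrict.comp hX.1
  have := Measure.isFiniteMeasure_map μ fun (g : ℚ≥0 → C) t => π (g t)
  have := Measure.isFiniteMeasure_map P fun ω => (X ω).restrict
  refine measure_ext_of_cylinderAt fun J e => ?_
  rw [Measure.map_apply hπm (measurableSet_cylinderAt J e),
    Measure.map_apply hXm (measurableSet_cylinderAt J e)]
  have hclopen : IsClopen (cylinderAt J e) := by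
    have : cylinderAt J e = ⋂ t ∈ J, (fun g : ℚ≥0 → E => g t) ⁻¹' {e t} := by
      ext g; simp [cylinderAt]
    rw [this]
    exact isClopen_biInter_finset fun t _ => (isClopen_discrete _).preimage (continuous_apply t)
  refine hμ _ (hclopen.preimage hπc) _ ?_
  filter_upwards [eventually_ge_atTop J] with I hI
  exact sampledLaw_preimage_cylinderAt hc₀ hr hq hX hπ h hI e

end Coupling

/-! ### Reconstruction of a path from its values at rational times -/

section Extension

theorem exists_nnrat_btwn {a b : ℝ≥0} (h : a < b) : ∃ t : ℚ≥0, a < t ∧ (t : ℝ≥0) < b := by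
  obtain ⟨r, hr0, har, hrb⟩ := (NNReal.lt_iff_exists_rat_btwn a b).1 h
  lift r to ℚ≥0 using hr0
  have hr : Real.toNNReal ((r : ℚ) : ℝ) = (r : ℝ≥0) := by
    ext
    rw [Real.coe_toNNReal _ (by positivity)]
    push_cast
    rfl
  exact ⟨r, hr ▸ har, hr ▸ hrb⟩

variable {E : Type*}

/-- A function of rational times that is right-continuous, and that changes its value at most once
on short intervals, uniformly on bounded intervals. The restrictions of càdlàg paths in a discrete
space are exactly these functions, and the definition involves only countably many conditions. -/
def IsRegular (x : ℚ≥0 → E) : Prop :=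
  (∀ t : ℚ≥0, ∃ u, t < u ∧ ∀ s, t ≤ s → s < u → x s = x t) ∧
    ∀ N : ℕ, ∃ δ : ℚ≥0, 0 < δ ∧ ∀ a b c : ℚ≥0, a < b → b < c → c ≤ N → c < a + δ →
      x a = x b ∨ x b = x c

theorem measurableSet_isRegular [MeasurableSpace E] [Countable E] [MeasurableSingletonClass E] :
    MeasurableSet {x : ℚ≥0 → E | IsRegular x} := by
  have heq : ∀ s t : ℚ≥0, Measurable fun x : ℚ≥0 → E => x s = x t := fun s t =>
    measurableSet_setOfPred.1
      (measurableSet_eq_fun (measurable_pi_apply s) (measurable_pi_apply t))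
  refine measurableSet_setOfPred.2 (.and (.forall fun t => .exists fun u => .and measurable_const
    (.forall fun s => .imp measurable_const (.imp measurable_const (heq s t))))
    (.forall fun N => .exists fun δ => .and measurable_const (.forall fun a => .forall fun b =>
      .forall fun c => .imp measurable_const (.imp measurable_const (.imp measurable_const
        (.imp measurable_const (.or (heq a b) (heq b c))))))))

/-- To the right of `t` the function is eventually constant: if it has a jump from `b` to `c` shortly
after `t`, then it has no other one before `b`. -/
theorem IsRegular.exists_right_value {x : ℚ≥0 → E} (hx : IsRegular x) (t : ℝ≥0) :
    ∃ e : E, ∃ u, t < u ∧ ∀ s : ℚ≥0, t < s → (s : ℝ≥0) < u → x s = e := by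
  obtain ⟨N, hN⟩ := exists_nat_gt t
  obtain ⟨δ, hδ, h⟩ := hx.2 N
  have hδ' : (0 : ℝ≥0) < δ := NNRat.cast_pos.2 hδ
  have htu : t < min (t + δ) N := lt_min (lt_add_of_pos_right t hδ') hN
  have h' : ∀ a b c : ℚ≥0, t < a → a < b → b < c → (c : ℝ≥0) < min (t + δ) N →
      x a = x b ∨ x b = x c := by
    intro a b c ha hab hbc hc
    rw [lt_min_iff] at hc
    refine h a b c hab hbc (by exact_mod_cast hc.2.le) ?_
    rw [← NNRat.cast_lt (K := ℝ≥0), NNRat.cast_add]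
    exact hc.1.trans (add_lt_add_left ha _)
  by_cases hjump : ∃ b c : ℚ≥0, t < b ∧ b < c ∧ (c : ℝ≥0) < min (t + δ) N ∧ x b ≠ x c
  · obtain ⟨b, c, hb, hbc, hc, hne⟩ := hjump
    exact ⟨x b, b, hb, fun s hs hsb =>
      (h' s b c hs (NNRat.cast_lt.1 hsb) hbc hc).resolve_right hne⟩
  · push Not at hjump
    obtain ⟨s₀, hs₀, hs₀u⟩ := exists_nnrat_btwn htu
    refine ⟨x s₀, _, htu, fun s hs hsu => ?_⟩
    rcases lt_trichotomy s s₀ with hlt | rfl | hlt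
    · exact hjump s s₀ hs hlt hs₀u
    · rfl
    · exact (hjump s₀ s hs₀ hlt hsu).symm

theorem IsRegular.exists_left_value {x : ℚ≥0 → E} (hx : IsRegular x) {t : ℝ≥0} (ht : 0 < t) :
    ∃ e : E, ∃ v, v < t ∧ ∀ s : ℚ≥0, v < s → (s : ℝ≥0) < t → x s = e := by
  obtain ⟨N, hN⟩ := exists_nat_gt t
  obtain ⟨δ, hδ, h⟩ := hx.2 N
  have hδ' : (0 : ℝ≥0) < δ := NNRat.cast_pos.2 hδ
  have hvt : t - δ < t := tsub_lt_self ht hδ'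
  have h' : ∀ a b c : ℚ≥0, t - δ < a → a < b → b < c → (c : ℝ≥0) < t → x a = x b ∨ x b = x c := by
    intro a b c ha hab hbc hc
    refine h a b c hab hbc (by exact_mod_cast (hc.trans hN).le) ?_
    rw [← NNRat.cast_lt (K := ℝ≥0), NNRat.cast_add]
    exact hc.trans (lt_add_of_tsub_lt_right ha)
  by_cases hjump : ∃ a b : ℚ≥0, t - δ < a ∧ a < b ∧ (b : ℝ≥0) < t ∧ x a ≠ x b
  · obtain ⟨a, b, ha, hab, hb, hne⟩ := hjump
    exact ⟨x b, b, hb, fun s hs hst =>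
      ((h' a b s ha hab (NNRat.cast_lt.1 hs) hst).resolve_left hne).symm⟩
  · push Not at hjump
    obtain ⟨s₀, hs₀, hs₀t⟩ := exists_nnrat_btwn hvt
    refine ⟨x s₀, _, hvt, fun s hs hst => ?_⟩
    rcases lt_trichotomy s s₀ with hlt | rfl | hlt
    · exact hjump s s₀ hs hlt hs₀t
    · rfl
    · exact (hjump s₀ s hs₀ hlt hst).symm

variable [TopologicalSpace E]

theorem IsRegular.exists_restrict_eq {x : ℚ≥0 → E} (hx : IsRegular x) :
    ∃ y : CadlagPath E, y.restrict = x := by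
  choose y u htu hy using hx.exists_right_value
  -- Near `t`, the value at an irrational time is the value at a slightly later rational time.
  have hval : ∀ s w : ℝ≥0, s < w → ∃ r : ℚ≥0, s < r ∧ (r : ℝ≥0) < w ∧ x r = y s := by
    intro s w hsw
    obtain ⟨r, hsr, hr⟩ := exists_nnrat_btwn (lt_min hsw (htu s))
    rw [lt_min_iff] at hr
    exact ⟨r, hsr, hr.1, hy s r hsr hr.2⟩
  refine ⟨⟨y, fun t => ⟨?_, ?_⟩⟩, ?_⟩
  · refine (tendsto_pure.2 ?_).mono_right (pure_le_nhds (y t))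
    filter_upwards [Ico_mem_nhdsGE (htu t)] with s hs
    rcases hs.1.eq_or_lt with rfl | hts
    · rfl
    · obtain ⟨r, hsr, hru, hr⟩ := hval s (u t) hs.2
      rw [← hr, hy t r (hts.trans hsr) hru]
  · rcases eq_zero_or_pos t with rfl | ht
    · exact ⟨y 0, by simp⟩
    · obtain ⟨e, v, hvt, he⟩ := hx.exists_left_value ht
      refine ⟨e, (tendsto_pure.2 ?_).mono_right (pure_le_nhds e)⟩
      filter_upwards [Ioo_mem_nhdsLT hvt] with s hs
      obtain ⟨r, hsr, hrt, hr⟩ := hval s t hs.2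
      rw [← hr, he r (hs.1.trans hsr) hrt]
  · ext t
    obtain ⟨w, htw, hw⟩ := hx.1 t
    obtain ⟨r, htr, hrw, hr⟩ := hval t w (NNRat.cast_lt.2 htw)
    change y t = x t
    rw [← hr, hw r (NNRat.cast_le.1 htr.le) (NNRat.cast_lt.1 hrw)]

open Classical in
/-- The càdlàg path that restricts to `x`; an arbitrary constant path if there is none. -/
noncomputable def extend [Nonempty E] (x : ℚ≥0 → E) : CadlagPath E :=
  if h : IsRegular x then h.exists_restrict_eq.choose
  else ⟨fun _ => Classical.arbitrary E,
    fun _ => ⟨continuousWithinAt_const, Classical.arbitrary E, tendsto_const_nhds⟩⟩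

theorem restrict_extend [Nonempty E] {x : ℚ≥0 → E} (hx : IsRegular x) : (extend x).restrict = x := by
  rw [extend, dif_pos hx]
  exact hx.exists_restrict_eq.choose_spec

theorem exists_rightApprox (t : ℝ≥0) :
    ∃ r : ℕ → ℚ≥0, Tendsto (fun n => (r n : ℝ≥0)) atTop (𝓝[≥] t) := by
  obtain ⟨v, -, hv, hlim⟩ := exists_seq_strictAnti_tendsto t
  choose r hr hrv using fun n => exists_nnrat_btwn (hv n)
  exact ⟨r, tendsto_nhdsWithin_iff.2 ⟨tendsto_of_tendsto_of_tendsto_of_le_of_le tendsto_const_nhds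
    hlim (fun n => (hr n).le) fun n => (hrv n).le, Eventually.of_forall fun n => (hr n).le⟩⟩

/-- A sequence of rational times that decreases to `t`. -/
noncomputable def rightApprox (t : ℝ≥0) : ℕ → ℚ≥0 :=
  (exists_rightApprox t).choose

variable [DiscreteTopology E]

theorem CadlagPath.eventually_restrict_rightApprox (y : CadlagPath E) (t : ℝ≥0) :
    ∀ᶠ n in atTop, y.restrict (rightApprox t n) = y.1 t := by
  have h : Tendsto (fun n => y.restrict (rightApprox t n)) atTop (𝓝 (y.1 t)) :=
    (y.2 t).1.tendsto.comp (exists_rightApprox t).choose_spec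
  rw [nhds_discrete] at h
  exact tendsto_pure.1 h

theorem CadlagPath.restrict_injective :
    Function.Injective (CadlagPath.restrict (E := E)) := by
  intro y y' h
  ext t
  obtain ⟨n, h1, h2⟩ := ((y.eventually_restrict_rightApprox t).and
    (y'.eventually_restrict_rightApprox t)).exists
  rw [← h1, ← h2, h]

theorem CadlagPath.isRegular_restrict (y : CadlagPath E) : IsRegular y.restrict := by
  have hR : ∀ t, ∀ᶠ s in 𝓝[≥] t, y.1 s = y.1 t := fun t => by
    have h : Tendsto y.1 (𝓝[≥] t) (𝓝 (y.1 t)) := (y.2 t).1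
    rw [nhds_discrete] at h
    exact tendsto_pure.1 h
  have hL : ∀ t, ∃ l, ∀ᶠ s in 𝓝[<] t, y.1 s = l := fun t => by
    obtain ⟨l, hl⟩ := (y.2 t).2
    rw [nhds_discrete] at hl
    exact ⟨l, tendsto_pure.1 hl⟩
  constructor
  · intro t
    obtain ⟨w, htw, hw⟩ := mem_nhdsGE_iff_exists_Ico_subset.1 (hR t)
    obtain ⟨r, htr, hrw⟩ := exists_nnrat_btwn htw
    exact ⟨r, NNRat.cast_lt.1 htr, fun s hts hsr =>
      hw ⟨NNRat.cast_le.2 hts, (NNRat.cast_lt.2 hsr).trans hrw⟩⟩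
  · intro N
    have hloc : ∀ t : ℝ≥0, ∃ U : Set ℝ≥0, IsOpen U ∧ t ∈ U ∧ ∀ a ∈ U, ∀ b ∈ U, ∀ c ∈ U,
        a < b → b < c → y.1 a = y.1 b ∨ y.1 b = y.1 c := by
      intro t
      obtain ⟨l, hl⟩ := hL t
      have h : ∀ᶠ s in 𝓝 t, (s < t → y.1 s = l) ∧ (t ≤ s → y.1 s = y.1 t) :=
        (eventually_nhdsWithin_iff.1 hl).and (eventually_nhdsWithin_iff.1 (hR t))
      obtain ⟨U, hU, hUo, htU⟩ := eventually_nhds_iff.1 h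
      refine ⟨U, hUo, htU, fun a ha b hb c hc hab hbc => ?_⟩
      rcases lt_or_ge b t with hbt | htb
      · exact Or.inl (((hU a ha).1 (hab.trans hbt)).trans ((hU b hb).1 hbt).symm)
      · exact Or.inr (((hU b hb).2 htb).trans ((hU c hc).2 (htb.trans hbc.le)).symm)
    choose U hUo hmem hU using hloc
    obtain ⟨δ, hδ, hball⟩ := lebesgue_number_lemma_of_metric
      (isCompact_Icc (a := (0 : ℝ≥0)) (b := (N : ℝ≥0))) hUo
      fun t _ => Set.mem_iUnion.2 ⟨t, hmem t⟩
    obtain ⟨ε, hε, hεδ⟩ := exists_nnrat_btwn (Real.toNNReal_pos.2 hδ)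
    have hεδ' : ((ε : ℝ≥0) : ℝ) < δ := by
      have := NNReal.coe_lt_coe.2 hεδ
      rwa [Real.coe_toNNReal _ hδ.le] at this
    refine ⟨ε, NNRat.cast_pos.1 hε, fun a b c hab hbc hcN hca => ?_⟩
    have hab' : (a : ℝ≥0) < b := NNRat.cast_lt.2 hab
    have hbc' : (b : ℝ≥0) < c := NNRat.cast_lt.2 hbc
    have hcN' : (c : ℝ≥0) ≤ N := by exact_mod_cast hcN
    have hca' : (c : ℝ≥0) < a + ε := by
      rw [← NNRat.cast_add]
      exact NNRat.cast_lt.2 hca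
    obtain ⟨t, ht⟩ := hball a ⟨zero_le, (hab'.trans hbc').le.trans hcN'⟩
    have hin : ∀ s : ℝ≥0, (a : ℝ≥0) ≤ s → s ≤ c → s ∈ U t := by
      intro s has hsc
      refine ht ?_
      rw [Metric.mem_ball, NNReal.dist_eq, abs_of_nonneg (sub_nonneg.2 (NNReal.coe_le_coe.2 has))]
      have := NNReal.coe_lt_coe.2 (hsc.trans_lt hca')
      push_cast at this hεδ'
      linarith
    exact hU t a (hin a le_rfl (hab'.trans hbc').le) b (hin b hab'.le hbc'.le) c
      (hin c (hab'.trans hbc').le le_rfl) hab' hbc'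

section Extend

variable [Nonempty E]

theorem extend_restrict (y : CadlagPath E) : extend y.restrict = y :=
  CadlagPath.restrict_injective (restrict_extend y.isRegular_restrict)

theorem measurable_extend [MeasurableSpace E] [Countable E] [MeasurableSingletonClass E] :
    Measurable (extend (E := E)) := by
  refine measurable_comap_iff.2 (measurable_pi_lambda _ fun t => measurable_to_countable' fun e => ?_)
  have h : (fun x : ℚ≥0 → E => (Subtype.val ∘ extend) x t) ⁻¹' {e} =
      {x | IsRegular x ∧ ∃ N, ∀ n, N ≤ n → x (rightApprox t n) = e} ∪
        {x | ¬IsRegular x ∧ Classical.arbitrary E = e} := by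
    ext x
    by_cases hx : IsRegular x
    · have hev := (extend x).eventually_restrict_rightApprox t
      rw [restrict_extend hx] at hev
      simp only [Set.mem_preimage, Set.mem_singleton_iff, Set.mem_union, Set.mem_ofPred_eq, hx,
        true_and, not_true_eq_false, false_and, or_false, Function.comp_apply,
        ← ge_iff_le, ← eventually_atTop]
      constructor
      · rintro rfl
        exact hev
      · intro he
        obtain ⟨n, h1, h2⟩ := (hev.and he).exists
        exact h1.symm.trans h2
    · simp [extend, hx]
  rw [h]
  have hreg : Measurable fun x : ℚ≥0 → E => IsRegular x :=
    measurableSet_setOfPred.1 measurableSet_isRegular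
  have hval : ∀ n, Measurable fun x : ℚ≥0 → E => x (rightApprox t n) = e := fun n =>
    measurableSet_setOfPred.1
      (measurableSet_eq_fun (measurable_pi_apply (rightApprox t n)) measurable_const)
  exact (measurableSet_setOfPred.2 (hreg.and (.exists fun N => .forall fun n =>
    .imp measurable_const (hval n)))).union
      (measurableSet_setOfPred.2 (hreg.not.and measurable_const))

end Extend

end Extension

/-! ### Stochastic order from a coupling at rational times -/

section Order

theorem CadlagPath.measurable_comp {E : Type*} [TopologicalSpace E] [MeasurableSpace E]
    [MeasurableSingletonClass E] [Countable E] {g : E → ℝ} (hg : Continuous g) :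
    Measurable (CadlagPath.comp g hg) :=
  measurable_comap_iff.2 (measurable_pi_lambda _ fun t =>
    (measurable_of_countable g).comp (CadlagPath.measurable_eval t))

theorem comp_extend_le_comp_extend {E F : Type*} [TopologicalSpace E] [DiscreteTopology E]
    [TopologicalSpace F] [DiscreteTopology F] [Nonempty E] [Nonempty F] {g : E → ℝ} {h : F → ℝ}
    (hg : Continuous g) (hh : Continuous h) {x : ℚ≥0 → E} {z : ℚ≥0 → F} (hx : IsRegular x)
    (hz : IsRegular z) (hle : ∀ t, g (x t) ≤ h (z t)) :
    (extend x).comp g hg ≤ (extend z).comp h hh := by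
  intro t
  have h1 := (extend x).eventually_restrict_rightApprox t
  have h2 := (extend z).eventually_restrict_rightApprox t
  rw [restrict_extend hx] at h1
  rw [restrict_extend hz] at h2
  obtain ⟨n, h1, h2⟩ := (h1.and h2).exists
  change g ((extend x).1 t) ≤ h ((extend z).1 t)
  rw [← h1, ← h2]
  exact hle _

variable {Ω W E F : Type*} [MeasurableSpace Ω] [MeasurableSpace W]
  [TopologicalSpace E] [DiscreteTopology E] [MeasurableSpace E] [MeasurableSingletonClass E]
  [Countable E] [TopologicalSpace F] [DiscreteTopology F] [MeasurableSpace F]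
  [MeasurableSingletonClass F] [Countable F]

/-- To compare the laws of two processes on path space, it suffices to couple their restrictions to
the rational times. -/
theorem stochLE_comp_of_coupling {P : Measure Ω} [IsProbabilityMeasure P] {g : E → ℝ} {h : F → ℝ}
    (hg : Continuous g) (hh : Continuous h) {X : Ω → CadlagPath E} {Z : Ω → CadlagPath F}
    (hX : Measurable X) (hZ : Measurable Z) {μ : Measure W} [IsFiniteMeasure μ]
    {U : W → ℚ≥0 → E} {V : W → ℚ≥0 → F} (hU : Measurable U) (hV : Measurable V)
    (hUX : μ.map U = P.map fun ω => (X ω).restrict) (hVZ : μ.map V = P.map fun ω => (Z ω).restrict)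
    (hle : ∀ w t, g (U w t) ≤ h (V w t)) :
    StochLE P P (fun ω => (X ω).comp g hg) (fun ω => (Z ω).comp h hh) := by
  rintro φ hφ ⟨K, hK⟩ hmono
  have hEne : Nonempty E := by
    obtain ⟨ω⟩ := nonempty_of_isProbabilityMeasure P
    exact ⟨(X ω).1 0⟩
  have hFne : Nonempty F := by
    obtain ⟨ω⟩ := nonempty_of_isProbabilityMeasure P
    exact ⟨(Z ω).1 0⟩
  have hXr : Measurable fun ω => (X ω).restrict := CadlagPath.measurable_restrict.comp hX
  have hZr : Measurable fun ω => (Z ω).restrict := CadlagPath.measurable_restrict.comp hZ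
  have hΦ : Measurable fun x : ℚ≥0 → E => φ ((extend x).comp g hg) :=
    hφ.comp ((CadlagPath.measurable_comp hg).comp measurable_extend)
  have hΨ : Measurable fun z : ℚ≥0 → F => φ ((extend z).comp h hh) :=
    hφ.comp ((CadlagPath.measurable_comp hh).comp measurable_extend)
  have hUreg : ∀ᵐ w ∂μ, IsRegular (U w) := by
    refine ae_of_ae_map (p := IsRegular) hU.aemeasurable ?_
    rw [hUX, ae_map_iff hXr.aemeasurable measurableSet_isRegular]
    exact Eventually.of_forall fun ω => (X ω).isRegular_restrict
  have hVreg : ∀ᵐ w ∂μ, IsRegular (V w) := by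
    refine ae_of_ae_map (p := IsRegular) hV.aemeasurable ?_
    rw [hVZ, ae_map_iff hZr.aemeasurable measurableSet_isRegular]
    exact Eventually.of_forall fun ω => (Z ω).isRegular_restrict
  have h1 : ∫ ω, φ ((X ω).comp g hg) ∂P = ∫ w, φ ((extend (U w)).comp g hg) ∂μ := by
    rw [← integral_map hU.aemeasurable hΦ.aestronglyMeasurable, hUX,
      integral_map hXr.aemeasurable hΦ.aestronglyMeasurable]
    simp only [extend_restrict]
  have h2 : ∫ ω, φ ((Z ω).comp h hh) ∂P = ∫ w, φ ((extend (V w)).comp h hh) ∂μ := by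
    rw [← integral_map hV.aemeasurable hΨ.aestronglyMeasurable, hVZ,
      integral_map hZr.aemeasurable hΨ.aestronglyMeasurable]
    simp only [extend_restrict]
  rw [h1, h2]
  refine integral_mono_ae (Integrable.of_bound (hΦ.comp hU).aestronglyMeasurable K
    (Eventually.of_forall fun w => hK _)) (Integrable.of_bound
      (hΨ.comp hV).aestronglyMeasurable K (Eventually.of_forall fun w => hK _)) ?_
  filter_upwards [hUreg, hVreg] with w hUw hVw
  exact hmono (comp_extend_le_comp_extend hg hh hUw hVw (hle w))

end Order

/-! ### The coupling of the loss systems -/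

section Moves

variable {K : ℕ} {m : Fin K → ℕ} {n : ℕ}

theorem unitVec_apply (i j : Fin 2) (l l' : Fin K) :
    unitVec i l j l' = if j = i ∧ l' = l then 1 else 0 := by
  unfold unitVec
  by_cases hj : j = i
  · subst hj
    by_cases hl : l' = l
    · subst hl; simp
    · simp [hl]
  · simp [hj]

theorem add_unitVec_zero_mem (x : State m n) (l : Fin K) (h : x.1 0 l < m l) :
    (∀ j, (x.1 + unitVec 0 l) 0 j ≤ m j) ∧ ∑ j, (x.1 + unitVec 0 l) 1 j ≤ n := by
  refine ⟨fun j => ?_, ?_⟩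
  · have := x.2.1 j
    simp only [Pi.add_apply, unitVec_apply]
    by_cases hj : j = l
    · subst hj; simp; omega
    · simp [hj, this]
  · simpa [unitVec_apply] using x.2.2

theorem add_unitVec_one_mem (x : State m n) (l : Fin K) (h : ∑ j, x.1 1 j < n) :
    (∀ j, (x.1 + unitVec 1 l) 0 j ≤ m j) ∧ ∑ j, (x.1 + unitVec 1 l) 1 j ≤ n := by
  refine ⟨fun j => ?_, ?_⟩
  · simpa [unitVec_apply] using x.2.1 j
  · simp only [Pi.add_apply, unitVec_apply, true_and, Finset.sum_add_distrib,
      Finset.sum_ite_eq', Finset.mem_univ, if_true]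
    omega

/-- The state after the arrival of a class-`l` customer. -/
def arrival (l : Fin K) (x : State m n) : State m n :=
  if h : x.1 0 l < m l then ⟨x.1 + unitVec 0 l, add_unitVec_zero_mem x l h⟩
  else if h : ∑ j, x.1 1 j < n then ⟨x.1 + unitVec 1 l, add_unitVec_one_mem x l h⟩
  else x

/-- The state after the departure of a class-`l` customer from layer `i`; the state does not change
if there is no such customer. -/
def departure (i : Fin 2) (l : Fin K) (x : State m n) : State m n :=
  ⟨x.1 - unitVec i l, fun _ => (Nat.sub_le _ _).trans (x.2.1 _),
    (Finset.sum_le_sum fun _ _ => Nat.sub_le _ _).trans x.2.2⟩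

/-- The number of customers in the Erlang loss system with `s` servers after an arrival. -/
def erlangUp {s : ℕ} (z : Fin (s + 1)) : Fin (s + 1) :=
  ⟨min (z + 1) s, by omega⟩

/-- The number of customers in the Erlang loss system with `s` servers after a departure. -/
def erlangDown {s : ℕ} (z : Fin (s + 1)) : Fin (s + 1) :=
  ⟨z - 1, by omega⟩

theorem sum_erlangRate_mul (s : ℕ) (lam mu : ℝ) (f : Fin (s + 1) → ℝ) (z : Fin (s + 1)) :
    ∑ y, erlangRate s lam mu z y * (f y - f z) =
      lam * (f (erlangUp z) - f z) + mu * ((z : ℕ) : ℝ) * (f (erlangDown z) - f z) := by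
  simp only [erlangRate, add_mul, Finset.sum_add_distrib]
  congr 1
  · by_cases hz : (z : ℕ) < s
    · rw [Finset.sum_eq_single (erlangUp z)]
      · rw [if_pos]
        exact ⟨by simp only [erlangUp]; omega, hz⟩
      · intro y _ hy
        rw [if_neg, zero_mul]
        rintro ⟨h, -⟩
        exact hy (Fin.ext (by simp only [erlangUp]; omega))
      · simp
    · have : erlangUp z = z := Fin.ext (by simp only [erlangUp]; omega)
      simp [hz, this]
  · rcases Nat.eq_zero_or_pos (z : ℕ) with hz | hz
    · simp [hz]
    · rw [Finset.sum_eq_single (erlangDown z)]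
      · rw [if_pos]
        simp only [erlangDown]; omega
      · intro y _ hy
        rw [if_neg, zero_mul]
        intro h
        exact hy (Fin.ext (by simp only [erlangDown]; omega))
      · simp

theorem sum_ite_add_unitVec (f : State m n → ℝ) (x x' : State m n) (e : Fin 2 → Fin K → ℕ)
    (h : x'.1 = x.1 + e) (a : ℝ) :
    ∑ y : State m n, (if y.1 = x.1 + e then a else 0) * (f y - f x) = a * (f x' - f x) := by
  rw [Finset.sum_eq_single x']
  · rw [if_pos h]
  · intro y _ hy
    rw [if_neg, zero_mul]
    exact fun h' => hy (Subtype.ext (h'.trans h.symm))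
  · simp

theorem sum_departure (f : State m n → ℝ) (x : State m n) (i : Fin 2) (l : Fin K) (b : ℝ) :
    ∑ y : State m n, (if x.1 = y.1 + unitVec i l then b * (x.1 i l : ℝ) else 0) * (f y - f x) =
      b * (x.1 i l : ℝ) * (f (departure i l x) - f x) := by
  rcases Nat.eq_zero_or_pos (x.1 i l) with h | h
  · simp [h]
  · rw [Finset.sum_eq_single (departure i l x)]
    · rw [if_pos]
      ext j l'
      simp only [departure, Pi.add_apply, Pi.sub_apply, unitVec_apply]
      split_ifs with hjl
      · obtain ⟨rfl, rfl⟩ := hjl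
        omega
      · omega
    · intro y _ hy
      rw [if_neg, zero_mul]
      intro h'
      refine hy (Subtype.ext ?_)
      simp only [departure, h']
      ext j l'
      simp
    · simp

theorem sum_arrival (f : State m n → ℝ) (x : State m n) (l : Fin K) (a : ℝ) :
    ∑ i, ∑ y : State m n, (if y.1 = x.1 + unitVec i l then
      (assignSet m n i l).indicator (fun _ => a) x else 0) * (f y - f x) =
      a * (f (arrival l x) - f x) := by
  have hx := x.2.1 l
  rw [Fin.sum_univ_two]
  by_cases h0 : x.1 0 l < m l
  · have h0' : x ∈ assignSet m n 0 l := h0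
    have h1' : x ∉ assignSet m n 1 l := fun h => h0.ne h.1
    have harr : (arrival l x).1 = x.1 + unitVec 0 l := by rw [arrival, dif_pos h0]
    rw [Set.indicator_of_mem h0', Set.indicator_of_notMem h1', sum_ite_add_unitVec f x _ _ harr]
    simp
  · have h0' : x ∉ assignSet m n 0 l := h0
    rw [Set.indicator_of_notMem h0']
    by_cases h1 : ∑ j, x.1 1 j < n
    · have h1' : x ∈ assignSet m n 1 l := ⟨le_antisymm hx (not_lt.1 h0), h1⟩
      have harr : (arrival l x).1 = x.1 + unitVec 1 l := by rw [arrival, dif_neg h0, dif_pos h1]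
      rw [Set.indicator_of_mem h1', sum_ite_add_unitVec f x _ _ harr]
      simp
    · have h1' : x ∉ assignSet m n 1 l := fun h => h1 h.2
      have harr : arrival l x = x := by rw [arrival, dif_neg h0, dif_neg h1]
      rw [Set.indicator_of_notMem h1', harr]
      simp

theorem sum_twoLayerRate_mul (lam mu : Fin K → ℝ) (f : State m n → ℝ) (x : State m n) :
    ∑ y, twoLayerRate m n lam mu x y * (f y - f x) =
      ∑ l, lam l * (f (arrival l x) - f x) +
        ∑ i, ∑ l, mu l * (x.1 i l : ℝ) * (f (departure i l x) - f x) := by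
  simp only [← sum_arrival, ← sum_departure, twoLayerRate, Finset.sum_mul, add_mul]
  rw [Finset.sum_comm, Finset.sum_comm (s := Finset.univ (α := Fin K)), ← Finset.sum_add_distrib]
  refine Finset.sum_congr rfl fun i _ => ?_
  rw [Finset.sum_comm, ← Finset.sum_add_distrib]
  exact Finset.sum_congr rfl fun l _ => Finset.sum_add_distrib

theorem twoLayerRate_nonneg {lam mu : Fin K → ℝ} (hlam : ∀ l, 0 ≤ lam l) (hmu : ∀ l, 0 ≤ mu l)
    (x y : State m n) : 0 ≤ twoLayerRate m n lam mu x y := by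
  refine Finset.sum_nonneg fun i _ => Finset.sum_nonneg fun l _ => add_nonneg ?_ ?_
  · split_ifs
    · exact Set.indicator_nonneg (fun _ _ => hlam l) x
    · exact le_rfl
  · split_ifs
    · exact mul_nonneg (hmu l) (Nat.cast_nonneg _)
    · exact le_rfl

theorem erlangRate_nonneg {lam mu : ℝ} (hlam : 0 ≤ lam) (hmu : 0 ≤ mu) (s : ℕ)
    (x y : Fin (s + 1)) : 0 ≤ erlangRate s lam mu x y := by
  unfold erlangRate
  positivity

theorem classTotal_arrival_of_ne {k l : Fin K} (h : k ≠ l) (x : State m n) :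
    classTotal m n k (arrival l x) = classTotal m n k x := by
  unfold arrival classTotal
  split_ifs <;> simp [unitVec_apply, h]

theorem classTotal_arrival_le (k : Fin K) (x : State m n) :
    classTotal m n k (arrival k x) ≤ min (classTotal m n k x + 1) (m k + n) := by
  have h0 := (arrival k x).2.1 k
  have h1 : (arrival k x).1 1 k ≤ ∑ l, (arrival k x).1 1 l :=
    Finset.single_le_sum (fun l _ => Nat.zero_le _) (Finset.mem_univ k)
  have h2 := (arrival k x).2.2
  refine le_min ?_ (by unfold classTotal; omega)
  unfold arrival classTotal
  split_ifs <;> simp [unitVec_apply] <;> omega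

theorem classTotal_departure_of_ne {k l : Fin K} (h : k ≠ l) (i : Fin 2) (x : State m n) :
    classTotal m n k (departure i l x) = classTotal m n k x := by
  simp [departure, classTotal, unitVec_apply, h]

theorem classTotal_departure (k : Fin K) (i : Fin 2) (x : State m n) (hx : x.1 i k ≠ 0) :
    classTotal m n k (departure i k x) = classTotal m n k x - 1 := by
  fin_cases i
  · simp [departure, classTotal, unitVec_apply] at hx ⊢
    omega
  · simp [departure, classTotal, unitVec_apply] at hx ⊢
    omega

end Moves

section Coupled

variable {K : ℕ} {m : Fin K → ℕ} {n : ℕ} {k : Fin K}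

/-- The state space of the coupling: the two-layer system holds at most as many class-`k` customers
as the Erlang system. -/
abbrev CoupledState (m : Fin K → ℕ) (n : ℕ) (k : Fin K) : Type :=
  {c : State m n × Fin (m k + n + 1) // classTotal m n k c.1 ≤ (c.2 : ℕ)}

/-- An arrival of a class-`l` customer, seen by both systems if `l = k`. -/
def coupledArrival (l : Fin K) (c : CoupledState m n k) : CoupledState m n k :=
  ⟨(arrival l c.1.1, if l = k then erlangUp c.1.2 else c.1.2), by
    have := c.2
    by_cases h : l = k
    · subst h
      have := classTotal_arrival_le l c.1.1
      simp only [if_true, erlangUp]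
      omega
    · simpa [h, classTotal_arrival_of_ne (Ne.symm h)] using this⟩

/-- A departure of a class-`l` customer from layer `i`, accompanied by a departure from the Erlang
system if `l = k`. -/
def coupledDeparture (i : Fin 2) (l : Fin K) (c : CoupledState m n k) : CoupledState m n k :=
  if hx : c.1.1.1 i l = 0 then c else
    ⟨(departure i l c.1.1, if l = k then erlangDown c.1.2 else c.1.2), by
      have := c.2
      by_cases h : l = k
      · subst h
        have := classTotal_departure l i c.1.1 hx
        simp only [if_true, erlangDown]
        omega
      · simpa [h, classTotal_departure_of_ne (Ne.symm h)] using this⟩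

/-- A departure from the Erlang system only. -/
def excessDeparture (c : CoupledState m n k) : CoupledState m n k :=
  if hx : classTotal m n k c.1.1 = (c.1.2 : ℕ) then c else
    ⟨(c.1.1, erlangDown c.1.2), by
      have := c.2
      simp only [erlangDown]
      omega⟩

/-- The transition rates of the coupling. Each customer of class `k` in the two-layer system is
paired with one in the Erlang system, and the excess customers of the latter leave on their own. -/
noncomputable def coupledRate (lam mu : Fin K → ℝ) (c d : CoupledState m n k) : ℝ :=
  ∑ l, lam l * (if d = coupledArrival l c then 1 else 0) +
    ∑ i, ∑ l, mu l * (c.1.1.1 i l : ℝ) * (if d = coupledDeparture i l c then 1 else 0) +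
    mu k * (((c.1.2 : ℕ) : ℝ) - (classTotal m n k c.1.1 : ℝ)) *
      (if d = excessDeparture c then 1 else 0)

theorem coupledRate_nonneg {lam mu : Fin K → ℝ} (hlam : ∀ l, 0 ≤ lam l) (hmu : ∀ l, 0 ≤ mu l)
    (c d : CoupledState m n k) : 0 ≤ coupledRate lam mu c d := by
  have h : (0 : ℝ) ≤ ((c.1.2 : ℕ) : ℝ) - (classTotal m n k c.1.1 : ℝ) :=
    sub_nonneg.2 (Nat.cast_le.2 c.2)
  have hite : ∀ p : Prop, ∀ [Decidable p], (0 : ℝ) ≤ if p then 1 else 0 := fun p _ => by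
    split_ifs <;> norm_num
  exact add_nonneg (add_nonneg (Finset.sum_nonneg fun l _ => mul_nonneg (hlam l) (hite _))
    (Finset.sum_nonneg fun i _ => Finset.sum_nonneg fun l _ =>
      mul_nonneg (mul_nonneg (hmu l) (Nat.cast_nonneg _)) (hite _)))
    (mul_nonneg (mul_nonneg (hmu k) h) (hite _))

theorem sum_coupledRate_mul (lam mu : Fin K → ℝ) (g : CoupledState m n k → ℝ)
    (c : CoupledState m n k) :
    ∑ d, coupledRate lam mu c d * (g d - g c) =
      ∑ l, lam l * (g (coupledArrival l c) - g c) +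
        ∑ i, ∑ l, mu l * (c.1.1.1 i l : ℝ) * (g (coupledDeparture i l c) - g c) +
        mu k * (((c.1.2 : ℕ) : ℝ) - (classTotal m n k c.1.1 : ℝ)) *
          (g (excessDeparture c) - g c) := by
  have hone : ∀ (a : ℝ) (b : CoupledState m n k),
      ∑ d, a * (if d = b then 1 else 0) * (g d - g c) = a * (g b - g c) := fun a b => by
    simp
  simp only [coupledRate, add_mul, Finset.sum_add_distrib, Finset.sum_mul, hone]
  congr 2
  · rw [Finset.sum_comm]
    simp only [hone]
  · rw [Finset.sum_comm]
    refine Finset.sum_congr rfl fun i _ => ?_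
    rw [Finset.sum_comm]
    simp only [hone]

/-- The first component of the coupling moves as the two-layer system. -/
theorem sum_coupledRate_fst (lam mu : Fin K → ℝ) (f : State m n → ℝ) (c : CoupledState m n k) :
    ∑ d, coupledRate lam mu c d * (f d.1.1 - f c.1.1) =
      ∑ y, twoLayerRate m n lam mu c.1.1 y * (f y - f c.1.1) := by
  rw [sum_coupledRate_mul lam mu (fun d => f d.1.1), sum_twoLayerRate_mul]
  have hex : (excessDeparture c).1.1 = c.1.1 := by
    unfold excessDeparture
    split_ifs <;> rfl
  have hdep : ∀ i l, mu l * (c.1.1.1 i l : ℝ) * (f (coupledDeparture i l c).1.1 - f c.1.1) =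
      mu l * (c.1.1.1 i l : ℝ) * (f (departure i l c.1.1) - f c.1.1) := fun i l => by
    by_cases h : c.1.1.1 i l = 0
    · simp [h]
    · rw [coupledDeparture, dif_neg h]
  simp only [hex, hdep, sub_self, mul_zero, add_zero]
  rfl

/-- The second component of the coupling moves as the Erlang system. -/
theorem sum_coupledRate_snd (lam mu : Fin K → ℝ) (f : Fin (m k + n + 1) → ℝ)
    (c : CoupledState m n k) :
    ∑ d, coupledRate lam mu c d * (f d.1.2 - f c.1.2) =
      ∑ y, erlangRate (m k + n) (lam k) (mu k) c.1.2 y * (f y - f c.1.2) := by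
  rw [sum_coupledRate_mul lam mu (fun d => f d.1.2), sum_erlangRate_mul]
  have harr : ∀ l, lam l * (f (coupledArrival l c).1.2 - f c.1.2) =
      if l = k then lam k * (f (erlangUp c.1.2) - f c.1.2) else 0 := fun l => by
    by_cases h : l = k
    · subst h; simp [coupledArrival]
    · simp [coupledArrival, h]
  have hdep : ∀ i l, mu l * (c.1.1.1 i l : ℝ) * (f (coupledDeparture i l c).1.2 - f c.1.2) =
      if l = k then mu k * (c.1.1.1 i k : ℝ) * (f (erlangDown c.1.2) - f c.1.2) else 0 :=
    fun i l => by
      by_cases hx : c.1.1.1 i l = 0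
      · by_cases h : l = k
        · subst h; simp [hx]
        · simp [hx, h]
      · rw [coupledDeparture, dif_neg hx]
        by_cases h : l = k
        · subst h; simp
        · simp [h]
  have hex : mu k * (((c.1.2 : ℕ) : ℝ) - (classTotal m n k c.1.1 : ℝ)) *
      (f (excessDeparture c).1.2 - f c.1.2) =
      mu k * (((c.1.2 : ℕ) : ℝ) - (classTotal m n k c.1.1 : ℝ)) *
        (f (erlangDown c.1.2) - f c.1.2) := by
    by_cases h : classTotal m n k c.1.1 = (c.1.2 : ℕ)
    · simp [h]
    · rw [excessDeparture, dif_neg h]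
  rw [hex]
  simp only [harr, hdep, Finset.sum_ite_eq', Finset.mem_univ, if_true, Fin.sum_univ_two,
    classTotal, Nat.cast_add]
  ring

end Coupled

end LossSystem

open LossSystem

theorem theorem6 {Ω : Type*} [MeasurableSpace Ω] (P : MeasureTheory.Measure Ω)
    [MeasureTheory.IsProbabilityMeasure P]
    (K : ℕ) (m : Fin K → ℕ) (n : ℕ) (lam mu : Fin K → ℝ)
    (hlam : ∀ l, 0 ≤ lam l) (hmu : ∀ l, 0 ≤ mu l) (k : Fin K)
    (X : Ω → LossSystem.CadlagPath (LossSystem.State m n))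
    (hX : LossSystem.IsMarkovProcess P (LossSystem.twoLayerRate m n lam mu) X)
    (Z : Ω → LossSystem.CadlagPath (Fin (m k + n + 1)))
    (hZ : LossSystem.IsMarkovProcess P (LossSystem.erlangRate (m k + n) (lam k) (mu k)) Z)
    (h0 : ∀ᵐ ω ∂P, LossSystem.classTotal m n k ((X ω).1 0) ≤ (((Z ω).1 0 : Fin (m k + n + 1)) : ℕ)) :
    LossSystem.StochLE P P (LossSystem.classProcess k X) (LossSystem.erlangProcess Z) := by
  classical
  have hX0 : Measurable fun ω => (X ω).1 0 := (CadlagPath.measurable_eval 0).comp hX.1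
  have hZ0 : Measurable fun ω => (Z ω).1 0 := (CadlagPath.measurable_eval 0).comp hZ.1
  -- The initial state of the coupling; the empty system replaces it on the null set where the
  -- initial states of `X` and `Z` are not ordered.
  let empty : CoupledState m n k :=
    ⟨(⟨0, fun _ => Nat.zero_le _, by simp⟩, 0), by simp [classTotal]⟩
  let toCoupled : State m n × Fin (m k + n + 1) → CoupledState m n k := fun p =>
    if h : classTotal m n k p.1 ≤ (p.2 : ℕ) then ⟨p, h⟩ else empty
  let c₀ : Ω → CoupledState m n k := fun ω => toCoupled ((X ω).1 0, (Z ω).1 0)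
  have hc₀ : Measurable c₀ := (measurable_of_countable toCoupled).comp (hX0.prodMk hZ0)
  have hc₀' : ∀ᵐ ω ∂P, (c₀ ω).1 = ((X ω).1 0, (Z ω).1 0) := h0.mono fun ω hω => by
    simp only [c₀, toCoupled]
    rw [dif_pos hω]
  obtain ⟨μ, _, hlim⟩ := exists_limit_sampledLaw (P := P) hc₀ (coupledRate_nonneg hlam hmu)
  have hmap : ∀ {E : Type} [MeasurableSpace E] (π : CoupledState m n k → E), Measurable
      fun (w : ℚ≥0 → CoupledState m n k) t => π (w t) := fun π =>
    measurable_pi_lambda _ fun t => (measurable_of_countable π).comp (measurable_pi_apply t)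
  exact stochLE_comp_of_coupling continuous_of_discreteTopology continuous_of_discreteTopology
    hX.1 hZ.1 (hmap fun c => c.1.1) (hmap fun c => c.1.2)
    (map_limit_sampledLaw hc₀ (coupledRate_nonneg hlam hmu) (twoLayerRate_nonneg hlam hmu) hX
      (hc₀'.mono fun ω hω => congrArg Prod.fst hω) (sum_coupledRate_fst lam mu) hlim)
    (map_limit_sampledLaw hc₀ (coupledRate_nonneg hlam hmu)
      (erlangRate_nonneg (hlam k) (hmu k) _) hZ
      (hc₀'.mono fun ω hω => congrArg Prod.snd hω) (sum_coupledRate_snd lam mu) hlim)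
    fun w t => Nat.cast_le.2 (w t).2
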